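/- Let $G$ be a countable group. The set $\mathrm{Sg}(G)$ of subgroups of $G$ carries the Borel structure inherited from $2^G$, and $\Gamma(G)\subseteq \mathrm{Sg}(G)$ denotes the space of infinite subgroups of $G$. For $A,B\in\mathrm{Sg}(G)$ write $$A\preccurlyeq_c^{G} B \iff \text{there are } k\ge 1 \text{ and } g_1,\dots,g_k\in G \text{ with } A=g_1Bg_1^{-1}\cap\dots\cap g_kBg_k^{-1}.$$ A countable Borel quasi-order is a reflexive and transitive relation $Q$ on a standard Borel space $X$ that is Borel as a subset of $X\times X$ and such that $\{x\in X : x\mathrel{Q}y\}$ is countable for every $y\in X$. It is universal if for every countable Borel quasi-order $R$ on a standard Borel space $Z$ there is a Borel map $f:Z\to X$ such that $z\mathrel{R}z'\iff f(z)\mathrel{Q}f(z')$ for all $z,z'\in Z$. **Corollary.** Let $\mathbb{F}_n$ be the free group on $n$ generators. For every $n\ge 2$, the restriction $\preccurlyeq_c^{\mathbb{F}_n}\restriction\Gamma(\mathbb{F}_n)$ is a universal countable Borel quasi-order on the standard Borel space $\Gamma(\mathbb{F}_n)$. In particular, $\preccurlyeq_c^{\mathbb{F}_2}\restriction\Gamma(\mathbb{F}_2)$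 is a universal countable Borel quasi-order. -/

import Mathlib

universe u v

/-- `Q` is a countable Borel quasi-order on `X`: `X` is a standard Borel space, `Q` is reflexive and
transitive, Borel as a subset of `X × X`, and every element has only countably many
predecessors. -/
structure IsCountableBorelQuasiOrder {X : Type*} [MeasurableSpace X] (Q : X → X → Prop) : Prop where
  standardBorel : StandardBorelSpace X
  refl : ∀ x, Q x x
  trans : ∀ x y z, Q x y → Q y z → Q x z
  borel : MeasurableSet {p : X × X | Q p.1 p.2}
  countable_below : ∀ y, {x | Q x y}.Countable

/-- Borel reducibility `Q ≤_B Q'`. -/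
def BorelReducible {X Y : Type*} [MeasurableSpace X] [MeasurableSpace Y]
    (Q : X → X → Prop) (Q' : Y → Y → Prop) : Prop :=
  ∃ f : X → Y, Measurable f ∧ ∀ x y, Q x y ↔ Q' (f x) (f y)

/-- `Q'` is a countable Borel quasi-order to which every countable Borel quasi-order (on a
standard Borel space in the universe `u`) is Borel reducible. -/
def IsUniversalCountableBorelQuasiOrder {Y : Type v} [MeasurableSpace Y]
    (Q' : Y → Y → Prop) : Prop :=
  IsCountableBorelQuasiOrder Q' ∧
    ∀ (X : Type u) [MeasurableSpace X] (Q : X → X → Prop),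
      IsCountableBorelQuasiOrder Q → BorelReducible Q Q'

/-- The Borel structure on the space of subgroups of `G`, as a subspace of the product space
`G → Prop` (that is, of the power set of `G`): it is generated by the sets `{H | g ∈ H}`. -/
instance subgroupMeasurableSpace (G : Type*) [Group G] : MeasurableSpace (Subgroup G) :=
  MeasurableSpace.comap (fun H : Subgroup G => (H : Set G)) inferInstance

/-- The space of infinite subgroups of `G`, with the Borel structure of a subspace of the
space of subgroups. -/
abbrev InfiniteSubgroup (G : Type*) [Group G] : Type _ :=
  {H : Subgroup G // (H : Set G).Infinite}

/-- The conjugate subgroup `g B g⁻¹`. -/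
def conjSubgroup {G : Type*} [Group G] (g : G) (B : Subgroup G) : Subgroup G :=
  B.map (MulAut.conj g).toMonoidHom

/-- `A` is the intersection `g₀ B g₀⁻¹ ∩ ⋯ ∩ gₙ B gₙ⁻¹` of finitely many (at least one) conjugates
of `B`. -/
def ConjIntersection {G : Type*} [Group G] (A B : Subgroup G) : Prop :=
  ∃ (n : ℕ) (g : Fin (n + 1) → G), A = ⨅ i, conjSubgroup (g i) B

/-- The restriction of `ConjIntersection` to the infinite subgroups of `G`. -/
def ConjIntersectionInf (G : Type*) [Group G] (A B : InfiniteSubgroup G) : Prop :=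
  ConjIntersection A.1 B.1

/-! ### Lusin–Novikov: σ-injective sets and families meeting a common fibre. -/

section LusinNovikov

open MeasureTheory Set TopologicalSpace Filter Topology

/-! By Lusin–Novikov, a countable Borel quasi-order `Q` is given by countably many Borel functions:
`Q x y` iff `x = h k y` for some `k`. A point `y` is coded by a set D(y) of positive words in the
free group on two letters 0, 1. Step words spell compositions of the `h k`, test words record which
separating sets contain the resulting point, and step words followed by 0 and anything serve as
padding. Then D(h k y) is the intersection of two translates of D(y) (`mul_mem_codeSet_iff`).
Conversely, if D(x) lies in a translate of D(y) that omits 1, the translating element acts as a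
product of step words, and the test words show that x is reached from y by the `h k`
(`exists_eq_applyList_of_baseAction`).

To pass from sets to subgroups, the given free group acts on `FreeGroup Bool × ℤ` over an action on
`FreeGroup Bool`, and a set D goes to the subgroup of the elements that preserve all fibres and move
only points over D. Conjugating the subgroup translates D, and intersecting subgroups intersects the
sets (`iInf_conjSubgroup_supportedSubgroup`). The positive words in D can be read off the subgroup
(`exists_mem_lampSubgroup_singleton`), which is all that the codes need. -/

/-- `A` is covered by countably many measurable sets on each of which `g` is injective. -/
def SigmaInjOn {F X : Type*} [MeasurableSpace F] (g : F → X) (A : Set F) : Prop :=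
  ∃ B : ℕ → Set F, (∀ n, MeasurableSet (B n) ∧ InjOn g (B n)) ∧ A ⊆ ⋃ n, B n

theorem SigmaInjOn.iUnion {F X ι : Type*} [MeasurableSpace F] [Countable ι] {g : F → X}
    {A : ι → Set F} (h : ∀ i, SigmaInjOn g (A i)) : SigmaInjOn g (⋃ i, A i) := by
  choose B hB hAB using h
  rcases isEmpty_or_nonempty ι with hι | hι
  · exact ⟨fun _ => ∅, fun _ => ⟨.empty, by simp⟩, by simp⟩
  obtain ⟨e, he⟩ := exists_surjective_nat (ι × ℕ)
  refine ⟨fun n => B (e n).1 (e n).2, fun n => hB _ _, iUnion_subset fun i x hx => ?_⟩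
  obtain ⟨m, hm⟩ := mem_iUnion.1 (hAB i hx)
  obtain ⟨n, hn⟩ := he (i, m)
  exact mem_iUnion.2 ⟨n, by simpa [hn] using hm⟩

theorem SigmaInjOn.of_injOn {F X : Type*} [MeasurableSpace F] {g : F → X} {A : Set F}
    (hA : MeasurableSet A) (h : InjOn g A) : SigmaInjOn g A :=
  ⟨fun _ => A, fun _ => ⟨hA, h⟩, fun _ hx => mem_iUnion.2 ⟨0, hx⟩⟩

theorem SigmaInjOn.union {F X : Type*} [MeasurableSpace F] {g : F → X} {A A' : Set F}
    (h : SigmaInjOn g A) (h' : SigmaInjOn g A') : SigmaInjOn g (A ∪ A') := by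
  rw [union_eq_iUnion]
  exact SigmaInjOn.iUnion fun b => by cases b <;> assumption

theorem AnalyticSet.inter {α : Type*} [TopologicalSpace α] [T2Space α] {s t : Set α}
    (hs : AnalyticSet s) (ht : AnalyticSet t) : AnalyticSet (s ∩ t) := by
  rw [inter_eq_iInter]
  exact AnalyticSet.iInter fun b => by cases b <;> assumption

/-- The members of `L` meet every Borel set with `SigmaInjOn` complement in a common fibre. -/
def CommonFibre {F X : Type*} [MeasurableSpace F] (g : F → X) (b : ℕ → Set F) (L : Finset ℕ) : Prop :=
  ∀ G : Set F, MeasurableSet G → SigmaInjOn g Gᶜ → ∃ x, ∀ i ∈ L, ∃ z ∈ b i ∩ G, g z = x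

/-- There are only countably many finite `L`. Each one that fails `CommonFibre` has a witness, and
the intersection of all witnesses still has σ-injective complement. On it, one fibre that meets the
family already proves `CommonFibre`. -/
theorem exists_conull_commonFibre {F X : Type*} [MeasurableSpace F] (g : F → X) (b : ℕ → Set F) :
    ∃ G : Set F, MeasurableSet G ∧ SigmaInjOn g Gᶜ ∧
      ∀ L : Finset ℕ, (∃ x, ∀ i ∈ L, ∃ z ∈ b i ∩ G, g z = x) → CommonFibre g b L := by
  have : ∀ L : Finset ℕ, ∃ G : Set F, MeasurableSet G ∧ SigmaInjOn g Gᶜ ∧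
      ((∃ x, ∀ i ∈ L, ∃ z ∈ b i ∩ G, g z = x) → CommonFibre g b L) := by
    intro L
    by_cases hL : CommonFibre g b L
    · exact ⟨univ, .univ, by simpa using SigmaInjOn.of_injOn .empty (by simp), fun _ => hL⟩
    · have hL' := hL
      simp only [CommonFibre, not_forall] at hL'
      obtain ⟨G, hG, hGs, h⟩ := hL'
      exact ⟨G, hG, hGs, fun h' => (h h').elim⟩
  choose G hG hGs hGL using this
  refine ⟨⋂ L, G L, .iInter hG, ?_, ?_⟩
  · rw [compl_iInter]
    exact SigmaInjOn.iUnion hGs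
  · rintro L ⟨x, hx⟩
    refine hGL L ⟨x, fun i hi => ?_⟩
    obtain ⟨z, ⟨hz, hzG⟩, h⟩ := hx i hi
    exact ⟨z, ⟨hz, mem_iInter.1 hzG L⟩, h⟩

variable {F X : Type*} [TopologicalSpace F] [PolishSpace F] [MeasurableSpace F] [BorelSpace F]
  [TopologicalSpace X] [T2Space X] [MeasurableSpace X] [BorelSpace X]

/-- An analytic set on which `g` is injective is contained in a Borel one. -/
theorem AnalyticSet.exists_measurableSet_injOn {g : F → X} (hg : Continuous g) {D : Set F}
    (hD : AnalyticSet D) (hinj : InjOn g D) :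
    ∃ B, MeasurableSet B ∧ D ⊆ B ∧ InjOn g B := by
  obtain ⟨b, hb⟩ := exists_seq_basis F
  have hbo : ∀ i, IsOpen (b i) := fun i => hb.isOpen (mem_range_self i)
  -- Injectivity on `D` makes the images of disjoint basic pieces disjoint analytic sets, so a Borel
  -- `W` separates them. The Borel hull consists of the points compatible with every `W i j`; two of
  -- its points with one image would lie in disjoint basic sets and put that image both in and
  -- outside some `W i j`.
  have key : ∀ i j, ∃ W : Set X, MeasurableSet W ∧ (Disjoint (b i) (b j) →
      g '' (D ∩ b i) ⊆ W ∧ Disjoint (g '' (D ∩ b j)) W) := by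
    intro i j
    by_cases hij : Disjoint (b i) (b j)
    · have hd : Disjoint (g '' (D ∩ b i)) (g '' (D ∩ b j)) := by
        rw [Set.disjoint_left]
        rintro _ ⟨z, ⟨hz, hzi⟩, rfl⟩ ⟨z', ⟨hz', hzj⟩, h⟩
        have := hinj hz' hz h
        subst this
        exact Set.disjoint_left.1 hij hzi hzj
      have han : ∀ i, AnalyticSet (g '' (D ∩ b i)) := fun i =>
        (AnalyticSet.inter hD (hbo i).measurableSet.analyticSet).image_of_continuous hg
      obtain ⟨W, h1, h2, h3⟩ := (han i).measurablySeparable (han j) hd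
      exact ⟨W, h3, fun _ => ⟨h1, h2⟩⟩
    · exact ⟨univ, .univ, fun h => (hij h).elim⟩
  choose W hW hWs using key
  refine ⟨⋂ i, ⋂ j, ⋂ _ : Disjoint (b i) (b j),
    ((b i)ᶜ ∪ g ⁻¹' W i j) ∩ ((b j)ᶜ ∪ (g ⁻¹' W i j)ᶜ), ?_, ?_, ?_⟩
  · refine .iInter fun i => .iInter fun j => .iInter fun _ => ?_
    have := hg.measurable (hW i j)
    exact ((hbo i).measurableSet.compl.union this).inter
      ((hbo j).measurableSet.compl.union this.compl)
  · intro z hz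
    simp only [mem_iInter]
    intro i j hij
    obtain ⟨h1, h2⟩ := hWs i j hij
    constructor
    · by_cases h : z ∈ b i
      · exact Or.inr (h1 ⟨z, ⟨hz, h⟩, rfl⟩)
      · exact Or.inl h
    · by_cases h : z ∈ b j
      · exact Or.inr (Set.disjoint_left.1 h2 ⟨z, ⟨hz, h⟩, rfl⟩)
      · exact Or.inl h
  · intro z hz z' hz' hgz
    by_contra hne
    obtain ⟨U, V, hU, hV, hzU, hzV, hUV⟩ := t2_separation hne
    obtain ⟨_, ⟨i, rfl⟩, hzi, hiU⟩ := hb.exists_subset_of_mem_open hzU hU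
    obtain ⟨_, ⟨j, rfl⟩, hzj, hjV⟩ := hb.exists_subset_of_mem_open hzV hV
    have hij := hUV.mono hiU hjV
    simp only [mem_iInter] at hz hz'
    have h1 := (hz i j hij).1
    have h2 := (hz' i j hij).2
    simp only [mem_union, mem_compl_iff, hzi, hzj, not_true_eq_false, false_or, mem_preimage]
      at h1 h2
    exact h2 (hgz ▸ h1)

/-- The points of `b i ∩ G` whose fibre meets every `b j ∩ G` form an analytic set. If `g` were
injective on it, a Borel hull with the same property could be removed from `G`, against
`CommonFibre`. -/
theorem CommonFibre.exists_ne {g : F → X} (hg : Continuous g) {b : ℕ → Set F}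
    (hb : ∀ i, IsOpen (b i)) {G : Set F} (hG : MeasurableSet G) (hGs : SigmaInjOn g Gᶜ)
    {L : Finset ℕ} (hL : CommonFibre g b L) {i : ℕ} (hi : i ∈ L) :
    ∃ z ∈ b i ∩ G, ∃ z' ∈ b i ∩ G, z ≠ z' ∧ g z = g z' ∧
      ∀ j ∈ L, ∃ w ∈ b j ∩ G, g w = g z := by
  set D : Set F := (b i ∩ G) ∩ g ⁻¹' ⋂ j : L, g '' (b j ∩ G) with hDdef
  have hm : ∀ j, AnalyticSet (b j ∩ G) := fun j => ((hb j).measurableSet.inter hG).analyticSet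
  have hD : AnalyticSet D := by
    have : Nonempty L := ⟨⟨i, hi⟩⟩
    exact AnalyticSet.inter (hm i)
      ((AnalyticSet.iInter fun j : L => (hm j).image_of_continuous hg).preimage hg)
  have hDi : ¬ InjOn g D := by
    intro hinj
    obtain ⟨B, hB, hDB, hBi⟩ := AnalyticSet.exists_measurableSet_injOn hg hD hinj
    obtain ⟨x, hx⟩ := hL (G ∩ Bᶜ) (hG.inter hB.compl) (by
      rw [compl_inter, compl_compl]
      exact hGs.union (.of_injOn hB hBi))
    obtain ⟨z, ⟨hz, hzG, hzB⟩, rfl⟩ := hx i hi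
    refine hzB (hDB ⟨⟨hz, hzG⟩, mem_iInter.2 fun j => ?_⟩)
    obtain ⟨w, ⟨hw, hwG, -⟩, h⟩ := hx j j.2
    exact ⟨w, ⟨hw, hwG⟩, h⟩
  simp only [InjOn, not_forall] at hDi
  obtain ⟨z, hz, z', hz', h, hne⟩ := hDi
  refine ⟨z, hz.1, z', hz'.1, hne, h, fun j hj => ?_⟩
  exact mem_iInter.1 hz.2 ⟨j, hj⟩

end LusinNovikov

/-! ### A Cantor scheme inside a single fibre. -/

section LusinNovikovScheme

open MeasureTheory Set TopologicalSpace Filter Topology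

/-- The `i'`-th set has small diameter and its closure is contained in the `i`-th set. -/
def IsSmallChild {F : Type*} [MetricSpace F] (b : ℕ → Set F) (ε : ℝ) (i i' : ℕ) : Prop :=
  closure (b i') ⊆ b i ∧ ∀ p ∈ b i', ∀ q ∈ b i', dist p q ≤ ε

theorem exists_isSmallChild {F : Type*} [MetricSpace F] {b : ℕ → Set F}
    (hb : IsTopologicalBasis (range b)) {i : ℕ} {z : F} (hz : z ∈ b i) {ε : ℝ} (hε : 0 < ε) :
    ∃ i', z ∈ b i' ∧ IsSmallChild b ε i i' ∧ b i' ⊆ Metric.ball z ε := by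
  obtain ⟨r, hr, hri⟩ := Metric.isOpen_iff.1 (hb.isOpen (mem_range_self i)) z hz
  set δ := min (r / 2) (ε / 2)
  have hδ : 0 < δ := by positivity
  have h1 : δ ≤ r / 2 := min_le_left _ _
  have h2 : δ ≤ ε / 2 := min_le_right _ _
  obtain ⟨_, ⟨j, rfl⟩, hzj, hj⟩ :=
    hb.exists_subset_of_mem_open (Metric.mem_ball_self hδ (x := z)) Metric.isOpen_ball
  refine ⟨j, hzj, ⟨?_, ?_⟩, hj.trans (Metric.ball_subset_ball (by linarith))⟩
  · refine Subset.trans ?_ hri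
    refine (closure_mono hj).trans (Metric.closure_ball_subset_closedBall.trans ?_)
    exact Metric.closedBall_subset_ball (by linarith)
  · intro p hp q hq
    have hp' := Metric.mem_ball.1 (hj hp)
    have hq' := Metric.mem_ball'.1 (hj hq)
    have := dist_triangle p z q
    linarith

variable {F X : Type*} [MetricSpace F] [PolishSpace F] [MeasurableSpace F] [BorelSpace F]
  [TopologicalSpace X] [T2Space X] [MeasurableSpace X] [BorelSpace X]

theorem CommonFibre.split {g : F → X} (hg : Continuous g) {b : ℕ → Set F}
    (hb : IsTopologicalBasis (range b)) {L : Finset ℕ} (hL : CommonFibre g b L) {i : ℕ}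
    (hi : i ∈ L) {ε : ℝ} (hε : 0 < ε) :
    ∃ i₀ i₁, CommonFibre g b (insert i₀ (insert i₁ L)) ∧ Disjoint (b i₀) (b i₁) ∧
      IsSmallChild b ε i i₀ ∧ IsSmallChild b ε i i₁ := by
  obtain ⟨G, hG, hGs, hGL⟩ := exists_conull_commonFibre g b
  obtain ⟨z, hz, z', hz', hne, h, hw⟩ :=
    hL.exists_ne hg (fun i => hb.isOpen (mem_range_self i)) hG hGs hi
  have hd : 0 < dist z z' := dist_pos.2 hne
  have hε' : 0 < min ε (dist z z' / 2) := by positivity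
  obtain ⟨i₀, hz₀, hc₀, hb₀⟩ := exists_isSmallChild hb hz.1 hε'
  obtain ⟨i₁, hz₁, hc₁, hb₁⟩ := exists_isSmallChild hb hz'.1 hε'
  have hm : ∀ j, IsSmallChild b (min ε (dist z z' / 2)) i j → IsSmallChild b ε i j :=
    fun j hj => ⟨hj.1, fun p hp q hq => (hj.2 p hp q hq).trans (min_le_left _ _)⟩
  refine ⟨i₀, i₁, hGL _ ⟨g z, ?_⟩, ?_, hm _ hc₀, hm _ hc₁⟩
  · simp only [Finset.mem_insert, forall_eq_or_imp]
    exact ⟨⟨z, ⟨hz₀, hz.2⟩, rfl⟩, ⟨z', ⟨hz₁, hz'.2⟩, h.symm⟩, hw⟩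
  · refine Disjoint.mono hb₀ hb₁ (Metric.ball_disjoint_ball ?_)
    have := min_le_right ε (dist z z' / 2)
    linarith

/-- The members are split one at a time. All earlier sets stay in the family, so a single fibre
still meets the result. -/
theorem CommonFibre.split_all {g : F → X} (hg : Continuous g) {b : ℕ → Set F}
    (hb : IsTopologicalBasis (range b)) {L : Finset ℕ} (hL : CommonFibre g b L)
    {ε : ℝ} (hε : 0 < ε) :
    ∃ L', CommonFibre g b L' ∧ ∀ i ∈ L, ∃ c : Bool → ℕ, (∀ e, c e ∈ L') ∧
      Disjoint (b (c false)) (b (c true)) ∧ ∀ e, IsSmallChild b ε i (c e) := by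
  have : ∀ T : Finset ℕ, T ⊆ L → ∃ L', L ⊆ L' ∧ CommonFibre g b L' ∧ ∀ i ∈ T, ∃ c : Bool → ℕ,
      (∀ e, c e ∈ L') ∧ Disjoint (b (c false)) (b (c true)) ∧
        ∀ e, IsSmallChild b ε i (c e) := by
    intro T
    induction T using Finset.induction_on with
    | empty => exact fun _ => ⟨L, Finset.Subset.refl _, hL, by simp⟩
    | insert i T _ ih =>
      intro hT
      obtain ⟨L', hLL', hL', hc⟩ := ih ((Finset.subset_insert _ _).trans hT)
      obtain ⟨i₀, i₁, h, hd, h₀, h₁⟩ :=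
        hL'.split hg hb (hLL' (hT (Finset.mem_insert_self _ _))) hε
      refine ⟨_, fun j hj => Finset.mem_insert_of_mem (Finset.mem_insert_of_mem (hLL' hj)), h, ?_⟩
      simp only [Finset.mem_insert, forall_eq_or_imp]
      refine ⟨⟨fun e => cond e i₁ i₀, ?_, hd, ?_⟩, fun j hj => ?_⟩
      · rintro (_ | _) <;> simp
      · rintro (_ | _) <;> assumption
      · obtain ⟨c, hc1, hc2⟩ := hc j hj
        exact ⟨c, fun e => Or.inr (Or.inr (hc1 e)), hc2⟩
  obtain ⟨L', -, h⟩ := this L (Finset.Subset.refl _)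
  exact ⟨L', h⟩

/-- Repeated splitting yields a binary tree of shrinking sets whose branches converge to distinct
points. At each level one fibre meets all the sets, so by continuity `g` takes the same value at all
the limits. -/
theorem CommonFibre.exists_uncountable_fibre [CompleteSpace F] {g : F → X} (hg : Continuous g)
    {b : ℕ → Set F} (hb : IsTopologicalBasis (range b)) {i₀ : ℕ} (h₀ : CommonFibre g b {i₀}) :
    ∃ x, ¬ (g ⁻¹' {x}).Countable := by
  have step : ∀ (n : ℕ) (L : {L : Finset ℕ // CommonFibre g b L}),
      ∃ L' : {L : Finset ℕ // CommonFibre g b L}, ∀ i ∈ L.1, ∃ c : Bool → ℕ, (∀ e, c e ∈ L'.1) ∧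
      Disjoint (b (c false)) (b (c true)) ∧ ∀ e, IsSmallChild b (1 / ((n : ℝ) + 1)) i (c e) := by
    intro n L
    obtain ⟨L', hL', h⟩ := L.2.split_all hg hb (ε := 1 / ((n : ℝ) + 1)) (by positivity)
    exact ⟨⟨L', hL'⟩, h⟩
  choose next hnext using step
  let L : ℕ → {L : Finset ℕ // CommonFibre g b L} := fun n => Nat.rec ⟨{i₀}, h₀⟩ next n
  have hL : ∀ n, L (n + 1) = next n (L n) := fun _ => rfl
  choose! c hc hcd hcs using fun n => hnext n (L n)
  let I : (ℕ → Bool) → ℕ → ℕ := fun a n => Nat.rec i₀ (fun n i => c n i (a n)) n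
  have hI : ∀ a n, I a (n + 1) = c n (I a n) (a n) := fun _ _ => rfl
  have hIL : ∀ a n, I a n ∈ (L n).1 := by
    intro a n
    induction n with
    | zero => exact Finset.mem_singleton_self _
    | succ n ih => rw [hI, hL]; exact hc n _ ih _
  have hchild : ∀ a (n : ℕ), IsSmallChild b (1 / ((n : ℝ) + 1)) (I a n) (I a (n + 1)) :=
    fun a n => hcs n _ (hIL a n) _
  have hanti : ∀ a, Antitone fun n => b (I a n) := fun a =>
    antitone_nat_of_succ_le fun n => subset_closure.trans (hchild a n).1
  have hpair : ∀ a a' n, ∃ p ∈ b (I a n), ∃ p' ∈ b (I a' n), g p = g p' := by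
    intro a a' n
    obtain ⟨x, hx⟩ := (L n).2 univ .univ (by
      simpa using SigmaInjOn.of_injOn (g := g) .empty (by simp))
    obtain ⟨p, hp, rfl⟩ := hx _ (hIL a n)
    obtain ⟨p', hp', h⟩ := hx _ (hIL a' n)
    exact ⟨p, hp.1, p', hp'.1, h.symm⟩
  have hlim0 : Tendsto (fun n : ℕ => 1 / ((n : ℝ) + 1)) atTop (𝓝 0) :=
    tendsto_one_div_add_atTop_nhds_zero_nat
  have hz : ∀ a, ∃ z, ∀ n, z ∈ b (I a n) := by
    intro a
    -- The points are taken one level down: the bound `1 / (n + 1)` concerns the set at level `n +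
    -- 1`.
    choose p hp _ _ _ using fun n => hpair a a (n + 1)
    have hcau : CauchySeq p := by
      refine cauchySeq_of_le_tendsto_0 _ (fun n m N hn hm => ?_) hlim0
      exact (hchild a N).2 _ (hanti a (Nat.succ_le_succ hn) (hp n))
        _ (hanti a (Nat.succ_le_succ hm) (hp m))
    obtain ⟨z, hz⟩ := cauchySeq_tendsto_of_complete hcau
    refine ⟨z, fun n => (hchild a n).1 ?_⟩
    refine mem_closure_of_tendsto hz ?_
    filter_upwards [eventually_ge_atTop n] with m hm
    exact hanti a (Nat.succ_le_succ hm) (hp m)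
  choose z hz using hz
  have hlim : ∀ a (p : ℕ → F), (∀ n, p n ∈ b (I a (n + 1))) → Tendsto p atTop (𝓝 (z a)) := by
    intro a p hp
    refine tendsto_iff_dist_tendsto_zero.2 (squeeze_zero (fun _ => dist_nonneg) (fun n => ?_) hlim0)
    exact (hchild a n).2 _ (hp n) _ (hz a (n + 1))
  have hgz : ∀ a a', g (z a) = g (z a') := by
    intro a a'
    choose p hp p' hp' h using fun n => hpair a a' (n + 1)
    refine tendsto_nhds_unique (hg.continuousAt.tendsto.comp (hlim a p hp)) ?_
    have : g ∘ p = g ∘ p' := funext h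
    rw [this]
    exact hg.continuousAt.tendsto.comp (hlim a' p' hp')
  have hinj : Function.Injective z := by
    intro a a' hzz
    by_contra hne
    have hne' : ∃ n, a n ≠ a' n := Function.ne_iff.1 hne
    classical
    obtain ⟨hn, hmin⟩ : a (Nat.find hne') ≠ a' (Nat.find hne') ∧ ∀ m < Nat.find hne', a m = a' m :=
      ⟨Nat.find_spec hne', fun m hm => not_not.1 (Nat.find_min hne' hm)⟩
    set n := Nat.find hne'
    have heq : ∀ m ≤ n, I a m = I a' m := by
      intro m
      induction m with
      | zero => exact fun _ => rfl
      | succ m ih =>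
        intro hm
        rw [hI, hI, ih (by omega), hmin m (by omega)]
    have h1 := hz a (n + 1)
    have h2 := hz a' (n + 1)
    rw [hI] at h1 h2
    rw [← heq n le_rfl, ← hzz] at h2
    have hd := Set.disjoint_left.1 (hcd n _ (hIL a n))
    cases ha : a n <;> cases ha' : a' n <;> simp only [ha, ha'] at h1 h2 hn
    · exact hn rfl
    · exact hd h1 h2
    · exact hd h2 h1
    · exact hn rfl
  refine ⟨g (z fun _ => false), fun hcount => ?_⟩
  have : Countable (ℕ → Bool) := by
    have := hcount.to_subtype
    exact Function.Injective.countable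
      (f := fun a => (⟨z a, hgz a _⟩ : g ⁻¹' {g (z fun _ => false)}))
      fun a a' h => hinj (Subtype.ext_iff.1 h)
  have : Countable (Set ℕ) :=
    Function.Injective.countable (f := fun (s : Set ℕ) n => (open Classical in decide (n ∈ s)))
      fun s t h => by ext n; simpa using congrFun h n
  obtain ⟨f, hf⟩ := exists_injective_nat (Set ℕ)
  exact Function.cantor_injective f hf

end LusinNovikovScheme

/-! ### From countable sections to countably many Borel functions. -/

section LusinNovikovUniformization

open MeasureTheory Set TopologicalSpace

/-- **Lusin–Novikov**, for a countable-to-one continuous map on a Polish space. -/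
theorem sigmaInjOn_univ_of_countable_fibres {F X : Type*} [TopologicalSpace F] [PolishSpace F]
    [MeasurableSpace F] [BorelSpace F] [TopologicalSpace X] [T2Space X] [MeasurableSpace X]
    [BorelSpace X] {g : F → X} (hg : Continuous g) (hc : ∀ x, (g ⁻¹' {x}).Countable) :
    SigmaInjOn g univ := by
  let _ := upgradeIsCompletelyMetrizable F
  obtain ⟨b, hb⟩ := exists_seq_basis F
  obtain ⟨G, hG, hGs, hGL⟩ := exists_conull_commonFibre g b
  have hGe : G = ∅ := by
    by_contra hne
    obtain ⟨z, hz⟩ := nonempty_iff_ne_empty.2 hne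
    obtain ⟨_, ⟨i, rfl⟩, hzi, -⟩ := hb.exists_subset_of_mem_open (mem_univ z) isOpen_univ
    obtain ⟨x, hx⟩ := (hGL {i} ⟨g z, by simpa using ⟨z, ⟨hzi, hz⟩, rfl⟩⟩).exists_uncountable_fibre
      hg hb
    exact hx (hc x)
  simpa [hGe] using hGs

/-- **Lusin–Novikov**: a Borel set in a product whose sections are countable is a countable union
of Borel sets on which the projection is injective. -/
theorem exists_iUnion_injOn_snd {X Y : Type*} [MeasurableSpace X] [StandardBorelSpace X]
    [MeasurableSpace Y] [StandardBorelSpace Y] {R : Set (X × Y)} (hR : MeasurableSet R)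
    (hc : ∀ y, {x | (x, y) ∈ R}.Countable) :
    ∃ B : ℕ → Set (X × Y), (∀ n, MeasurableSet (B n) ∧ InjOn Prod.snd (B n)) ∧ R = ⋃ n, B n := by
  let _ := upgradeStandardBorel X
  let _ := upgradeStandardBorel Y
  -- A finer Polish topology with the same Borel sets makes `R` closed, hence Polish, and keeps the
  -- projection continuous.
  obtain ⟨t, htle, ht, hcl, -⟩ := hR.isClopenable
  have hb : @borel _ t = Prod.instMeasurableSpace := by
    rw [@borel_eq_borel_of_le _ t instTopologicalSpaceProd ht inferInstance htle]
    exact (BorelSpace.measurable_eq).symm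
  have hsnd : @Continuous _ _ t _ (Prod.snd : X × Y → Y) :=
    continuous_le_dom htle continuous_snd
  have hcont : @Continuous _ _ (@instTopologicalSpaceSubtype _ _ t) _ (fun p : R => p.1.2) :=
    @Continuous.comp _ _ _ (_) (t) (_) _ _ hsnd (@continuous_subtype_val _ t _)
  have hpol : @PolishSpace R (@instTopologicalSpaceSubtype _ _ t) :=
    @IsClosed.polishSpace _ t ht _ hcl
  have hbor : @BorelSpace R (@instTopologicalSpaceSubtype _ _ t) _ :=
    @Subtype.borelSpace _ t _ ⟨hb.symm⟩ _
  have hfib : ∀ y, ((fun p : R => p.1.2) ⁻¹' {y}).Countable := by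
    intro y
    refine Set.MapsTo.countable_of_injOn (f := fun p : R => p.1.1) (t := {x | (x, y) ∈ R}) ?_ ?_ (hc y)
    · rintro ⟨⟨a, b⟩, hp⟩ rfl
      exact hp
    · rintro ⟨⟨a, b⟩, hp⟩ h ⟨⟨a', b'⟩, hp'⟩ h' haa
      simp only [mem_preimage, mem_singleton_iff] at h h' haa
      subst h h' haa
      rfl
  obtain ⟨B, hB, hBu⟩ := @sigmaInjOn_univ_of_countable_fibres R Y
    (@instTopologicalSpaceSubtype _ _ t) hpol _ hbor _ _ _ _ _ hcont hfib
  refine ⟨fun n => Subtype.val '' B n, fun n => ⟨hR.subtype_image (hB n).1, ?_⟩, ?_⟩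
  · rintro _ ⟨p, hp, rfl⟩ _ ⟨q, hq, rfl⟩ h
    exact congrArg _ ((hB n).2 hp hq h)
  · rw [← image_iUnion, univ_subset_iff.1 hBu, image_univ, Subtype.range_val]

/-- A countable Borel quasi-order is generated by countably many Borel functions. -/
theorem IsCountableBorelQuasiOrder.exists_measurable_functions {X : Type*} [MeasurableSpace X]
    {Q : X → X → Prop} (hQ : IsCountableBorelQuasiOrder Q) :
    ∃ h : ℕ → X → X, (∀ n, Measurable (h n)) ∧ ∀ x y, Q x y ↔ ∃ n, x = h n y := by
  have := hQ.standardBorel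
  obtain ⟨B, hB, hBu⟩ := exists_iUnion_injOn_snd hQ.borel hQ.countable_below
  have hfun : ∀ n, ∃ f : X → X, Measurable f ∧ (∀ p ∈ B n, p.1 = f p.2) ∧ ∀ y, Q (f y) y := by
    intro n
    have hD : MeasurableSet (Prod.snd '' B n) :=
      (hB n).1.image_of_measurable_injOn measurable_snd (hB n).2
    classical
    -- The default value `y` is harmless because `Q` is reflexive.
    let f : X → X := fun y => if h : y ∈ Prod.snd '' B n then h.choose.1 else y
    have hf : ∀ p ∈ B n, p.1 = f p.2 := by
      intro p hp
      have h : p.2 ∈ Prod.snd '' B n := ⟨p, hp, rfl⟩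
      have hs := h.choose_spec
      simp only [f, dif_pos h]
      rw [(hB n).2 hs.1 hp hs.2]
    refine ⟨f, ?_, hf, fun y => ?_⟩
    · intro s hs
      have : f ⁻¹' s = Prod.snd '' (B n ∩ Prod.fst ⁻¹' s) ∪ ((Prod.snd '' B n)ᶜ ∩ s) := by
        ext y
        by_cases h : y ∈ Prod.snd '' B n
        · obtain ⟨p, hp, rfl⟩ := h
          have : ∀ q, q ∈ B n → q.2 = p.2 → q = p := fun q hq => (hB n).2 hq hp
          have hmem : p.2 ∈ Prod.snd '' B n := ⟨p, hp, rfl⟩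
          simp only [mem_preimage, ← hf p hp, mem_union, mem_inter_iff, mem_compl_iff, hmem,
            not_true_eq_false, false_and, or_false]
          constructor
          · exact fun h => ⟨p, ⟨hp, h⟩, rfl⟩
          · rintro ⟨q, ⟨hq, hqs⟩, h⟩
            rwa [this q hq h] at hqs
        · have h' : y ∉ Prod.snd '' (B n ∩ Prod.fst ⁻¹' s) :=
            fun h' => h (image_mono inter_subset_left h')
          have hfy : f y = y := dif_neg h
          simp only [mem_preimage, hfy, mem_union, h', false_or, mem_inter_iff, mem_compl_iff, h,
            not_false_eq_true, true_and]
      rw [this]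
      exact (((hB n).1.inter (measurable_fst hs)).image_of_measurable_injOn measurable_snd
        ((hB n).2.mono inter_subset_left)).union (hD.compl.inter hs)
    · by_cases h : y ∈ Prod.snd '' B n
      · obtain ⟨p, hp, rfl⟩ := h
        rw [← hf p hp]
        have : p ∈ {p : X × X | Q p.1 p.2} := hBu ▸ mem_iUnion.2 ⟨n, hp⟩
        exact this
      · have hfy : f y = y := dif_neg h
        rw [hfy]
        exact hQ.refl y
  choose f hfm hf hfQ using hfun
  refine ⟨f, hfm, fun x y => ⟨fun hxy => ?_, ?_⟩⟩
  · have : (x, y) ∈ {p : X × X | Q p.1 p.2} := hxy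
    rw [hBu] at this
    obtain ⟨n, hn⟩ := mem_iUnion.1 this
    exact ⟨n, hf n _ hn⟩
  · rintro ⟨n, rfl⟩
    exact hfQ n y

end LusinNovikovUniformization

/-! ### Coding points by languages of binary words. -/

section BinaryCodes

/-- The code word `1ᵏ⁺¹01` of the `k`-th function. -/
def stepWord (k : ℕ) : List Bool := List.replicate (k + 1) true ++ [false, true]

/-- The code word `1ʲ⁺¹001` of the `j`-th test set. -/
def testWord (j : ℕ) : List Bool := List.replicate (j + 1) true ++ [false, false, true]

/-- The concatenation of the code words of a list of functions. -/
def stepWords (ks : List ℕ) : List Bool := ks.flatMap stepWord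

/-- Apply the functions listed in `ks` one after the other, the head first. -/
def applyList {X : Type*} (h : ℕ → X → X) (ks : List ℕ) (y : X) : X :=
  ks.foldl (fun x k => h k x) y

/-- The code of a point `y`: a language recording which of the sets `P j` contain which of
the images of `y` under compositions of the functions `h k`, together with all words that start
with a sequence of step words followed by `0`. -/
def pointCode {X : Type*} (h : ℕ → X → X) (P : ℕ → Set X) (y : X) : Set (List Bool) :=
  {w | ∃ ks, (∃ m, w = stepWords ks ++ false :: m) ∨
    ∃ j, w = stepWords ks ++ testWord j ∧ applyList h ks y ∈ P j}

theorem replicate_true_append_inj {k k' : ℕ} {r r' : List Bool}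
    (h : List.replicate k true ++ false :: r = List.replicate k' true ++ false :: r') :
    k = k' ∧ r = r' := by
  induction k generalizing k' with
  | zero => cases k' <;> simp_all [List.replicate_succ]
  | succ k ih =>
    cases k' with
    | zero => simp [List.replicate_succ] at h
    | succ k' =>
      simp only [List.replicate_succ, List.cons_append, List.cons.injEq, true_and] at h
      simpa using ih h

variable {X : Type*} {h : ℕ → X → X} {P : ℕ → Set X} {y : X}

theorem measurableSet_mem_pointCode [MeasurableSpace X] (hh : ∀ k, Measurable (h k))
    (hP : ∀ j, MeasurableSet (P j)) (w : List Bool) : MeasurableSet {y | w ∈ pointCode h P y} := by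
  have hact : ∀ ks, Measurable (applyList h ks) := by
    intro ks
    induction ks with
    | nil => exact measurable_id
    | cons k ks ih => exact ih.comp (hh k)
  have : {y | w ∈ pointCode h P y} = ⋃ ks : List ℕ,
      ({_y | ∃ m, w = stepWords ks ++ false :: m} ∪
        ⋃ j : ℕ, ({_y | w = stepWords ks ++ testWord j} ∩ applyList h ks ⁻¹' P j)) := by
    ext y
    simp [pointCode]
  rw [this]
  exact .iUnion fun ks => .union (.const _) (.iUnion fun j => .inter (.const _) (hact ks (hP j)))

theorem false_cons_mem_pointCode (m : List Bool) : false :: m ∈ pointCode h P y :=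
  ⟨[], Or.inl ⟨m, rfl⟩⟩

theorem nil_notMem_pointCode : [] ∉ pointCode h P y := by
  rintro ⟨ks, ⟨m, hm⟩ | ⟨j, hj, -⟩⟩
  · simp at hm
  · simp [testWord] at hj

/-- Parsing is unique: the initial run of 1s gives the index, and the letter after the next 0 tells
a step word from a test word. -/
theorem stepWord_append_mem_pointCode {k : ℕ} {w : List Bool} :
    stepWord k ++ w ∈ pointCode h P y ↔ w ∈ pointCode h P (h k y) := by
  constructor
  · rintro ⟨ks, hks⟩
    rcases ks with _ | ⟨k', ks⟩
    · rcases hks with ⟨m, hm⟩ | ⟨j, hj, -⟩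
      · simp [stepWord, stepWords, List.replicate_succ] at hm
      · have := replicate_true_append_inj (by simpa [stepWord, stepWords, testWord] using hj)
        simp at this
    · have key : ∀ r, stepWord k ++ w = stepWords (k' :: ks) ++ r → k = k' ∧ w = stepWords ks ++ r := by
        intro r hr
        have := replicate_true_append_inj
          (k := k + 1) (k' := k' + 1) (r := true :: w) (r' := true :: (stepWords ks ++ r))
          (by simpa [stepWord, stepWords] using hr)
        simpa using this
      rcases hks with ⟨m, hm⟩ | ⟨j, hj, hjP⟩
      · obtain ⟨rfl, rfl⟩ := key _ hm
        exact ⟨ks, Or.inl ⟨m, rfl⟩⟩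
      · obtain ⟨rfl, rfl⟩ := key _ hj
        exact ⟨ks, Or.inr ⟨j, rfl, hjP⟩⟩
  · rintro ⟨ks, ⟨m, rfl⟩ | ⟨j, rfl, hj⟩⟩
    · exact ⟨k :: ks, Or.inl ⟨m, by simp [stepWords]⟩⟩
    · exact ⟨k :: ks, Or.inr ⟨j, by simp [stepWords], hj⟩⟩

theorem stepWords_append_mem_pointCode {ks : List ℕ} {w : List Bool} :
    stepWords ks ++ w ∈ pointCode h P y ↔ w ∈ pointCode h P (applyList h ks y) := by
  induction ks generalizing y with
  | nil => rfl
  | cons k ks ih =>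
    have : stepWords (k :: ks) ++ w = stepWord k ++ (stepWords ks ++ w) := by simp [stepWords]
    rw [this, stepWord_append_mem_pointCode, ih]
    rfl

theorem testWord_mem_pointCode {j : ℕ} : testWord j ∈ pointCode h P y ↔ y ∈ P j := by
  constructor
  · rintro ⟨ks, hks⟩
    rcases ks with _ | ⟨k, ks⟩
    · rcases hks with ⟨m, hm⟩ | ⟨j', hj, hP⟩
      · simp [testWord, stepWords, List.replicate_succ] at hm
      · have := replicate_true_append_inj (k := j + 1) (k' := j' + 1) (r := [false, true])
          (r' := [false, true]) (by simpa [stepWords, testWord] using hj)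
        obtain rfl : j = j' := by simpa using this
        exact hP
    · have : ∀ r, testWord j ≠ stepWords (k :: ks) ++ r := by
        intro r hr
        have := replicate_true_append_inj
          (k := j + 1) (k' := k + 1) (r := [false, true]) (r' := true :: (stepWords ks ++ r))
          (by simpa [stepWord, testWord, stepWords] using hr)
        simp at this
      rcases hks with ⟨m, hm⟩ | ⟨j, hj, -⟩
      · exact (this _ hm).elim
      · exact (this _ hj).elim
  · exact fun hj => ⟨[], Or.inr ⟨j, rfl, hj⟩⟩

/-- Test words end in 1, so `v ++ [false]` is padding; if its padding 0 were not the last letter,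
`v` itself would be in the code. -/
theorem exists_eq_stepWords_of_append_false {v : List Bool} (hv : v ∉ pointCode h P y)
    (hv' : v ++ [false] ∈ pointCode h P y) : ∃ ks, v = stepWords ks := by
  obtain ⟨ks, ⟨m, hm⟩ | ⟨j, hj, -⟩⟩ := hv'
  · refine ⟨ks, ?_⟩
    rcases List.eq_nil_or_concat m with rfl | ⟨m, c, rfl⟩
    · exact List.append_cancel_right hm
    · refine (hv ⟨ks, Or.inl ⟨m, ?_⟩⟩).elim
      have : v ++ [false] = (stepWords ks ++ false :: m) ++ [c] := by simpa using hm
      exact (List.append_inj' this rfl).1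
  · have : v ++ [false] = (stepWords ks ++ (List.replicate (j + 1) true ++ [false, false]))
      ++ [true] := by simpa [testWord] using hj
    have := (List.append_inj' this rfl).2
    simp at this

/-- Test words end in 01, and padding that ends in 11 remains padding when these two letters are
dropped. This excludes the exchange of generators later on. -/
theorem append_true_true_notMem_pointCode {v : List Bool} (hv : v ∉ pointCode h P y) :
    v ++ [true, true] ∉ pointCode h P y := by
  rintro ⟨ks, ⟨m, hm⟩ | ⟨j, hj, -⟩⟩
  · rcases List.eq_nil_or_concat m with rfl | ⟨m, c, rfl⟩
    · have : (v ++ [true]) ++ [true] = stepWords ks ++ [false] := by simpa using hm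
      have := (List.append_inj' this rfl).2
      simp at this
    · have : (v ++ [true]) ++ [true] = (stepWords ks ++ false :: m) ++ [c] := by simpa using hm
      have := (List.append_inj' this rfl).1
      rcases List.eq_nil_or_concat m with rfl | ⟨m, c, rfl⟩
      · have := (List.append_inj' this rfl).2
        simp at this
      · have : v ++ [true] = (stepWords ks ++ false :: m) ++ [c] := by simpa using this
        exact hv ⟨ks, Or.inl ⟨m, (List.append_inj' this rfl).1⟩⟩
  · have : v ++ [true, true] = (stepWords ks ++ (List.replicate (j + 1) true ++ [false]))
      ++ [false, true] := by simpa [testWord] using hj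
    have := (List.append_inj' this rfl).2
    simp at this

theorem eq_applyList_of_subset {x : X} (hsep : ∀ x x', (∀ j, x ∈ P j → x' ∈ P j) → x = x')
    {ks : List ℕ} (hs : ∀ w ∈ pointCode h P x, stepWords ks ++ w ∈ pointCode h P y) :
    x = applyList h ks y :=
  hsep _ _ fun _ hj => testWord_mem_pointCode.1 <|
    stepWords_append_mem_pointCode.1 <| hs _ (testWord_mem_pointCode.2 hj)

end BinaryCodes

/-! ### Positive elements of the free group. -/

section PositiveWords

/-- The element of the free group on two generators given by a word without inverses. -/
def posWord (l : List Bool) : FreeGroup Bool := FreeGroup.mk (l.map fun c => (c, true))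

theorem posWord_append (l l' : List Bool) : posWord (l ++ l') = posWord l * posWord l' := by
  simp [posWord]

theorem isReduced_map_true (l : List Bool) :
    FreeGroup.IsReduced (l.map fun c => (c, true)) := by
  rw [FreeGroup.IsReduced, List.isChain_map]
  exact (List.pairwise_of_forall fun _ _ _ => rfl).isChain

theorem toWord_posWord (l : List Bool) : (posWord l).toWord = l.map fun c => (c, true) := by
  rw [posWord, FreeGroup.toWord_mk, (isReduced_map_true l).reduce_eq]

theorem posWord_injective : Function.Injective posWord := by
  intro l l' h
  have := congrArg FreeGroup.toWord h
  rw [toWord_posWord, toWord_posWord] at this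
  exact List.map_injective_iff.2 (fun a b h => (Prod.ext_iff.1 h).1) this

theorem mem_range_posWord_iff {v : FreeGroup Bool} :
    v ∈ Set.range posWord ↔ ∀ p ∈ v.toWord, p.2 = true := by
  constructor
  · rintro ⟨l, rfl⟩
    simp [toWord_posWord]
  · intro h
    refine ⟨v.toWord.map Prod.fst, ?_⟩
    rw [posWord, List.map_map, ← FreeGroup.mk_toWord (x := v)]
    congr 1
    rw [FreeGroup.mk_toWord]
    conv_rhs => rw [← List.map_id v.toWord]
    refine List.map_congr_left fun p hp => ?_
    exact Prod.ext rfl (h p hp).symm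

/-- The last letter of `v` cannot be inverse to both generators, so in one of the two products
nothing cancels and `v` is an initial segment of a positive reduced word. -/
theorem mem_range_posWord_of_mul {v : FreeGroup Bool} {m m' : List Bool}
    (h : v * posWord (false :: m) ∈ Set.range posWord)
    (h' : v * posWord (true :: m') ∈ Set.range posWord) : v ∈ Set.range posWord := by
  have key : ∀ (c : Bool) (m : List Bool), v * posWord (c :: m) ∈ Set.range posWord →
      (c, false) ∉ v.toWord.getLast? → v ∈ Set.range posWord := by
    intro c m h hc
    have hred : FreeGroup.IsReduced (v.toWord ++ (c :: m).map fun c => (c, true)) := by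
      refine List.IsChain.append FreeGroup.isReduced_toWord (isReduced_map_true _) ?_
      rintro ⟨d, e⟩ hd b hb rfl
      simp only [List.map_cons, List.head?_cons, Option.mem_def, Option.some.injEq] at hb
      subst hb
      cases e
      · exact (hc hd).elim
      · rfl
    rw [mem_range_posWord_iff] at h ⊢
    intro p hp
    apply h
    rw [← FreeGroup.mk_toWord (x := v), posWord, FreeGroup.mul_mk, FreeGroup.toWord_mk,
      hred.reduce_eq]
    exact List.mem_append_left _ hp
  by_cases hf : (false, false) ∈ v.toWord.getLast?
  · refine key true m' h' fun ht => ?_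
    have := Option.mem_unique hf ht
    simp at this
  · exact key false m h hf

theorem mem_range_posWord_of_mul_left {v : FreeGroup Bool} {m m' : List Bool}
    (h : posWord (m ++ [false]) * v ∈ Set.range posWord)
    (h' : posWord (m' ++ [true]) * v ∈ Set.range posWord) : v ∈ Set.range posWord := by
  have key : ∀ (c : Bool) (m : List Bool), posWord (m ++ [c]) * v ∈ Set.range posWord →
      (c, false) ∉ v.toWord.head? → v ∈ Set.range posWord := by
    intro c m h hc
    have hred : FreeGroup.IsReduced ((m ++ [c]).map (fun c => (c, true)) ++ v.toWord) := by
      refine List.IsChain.append (isReduced_map_true _) FreeGroup.isReduced_toWord ?_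
      rintro a ha ⟨d, e⟩ hd h
      simp only [List.map_append, List.map_cons, List.map_nil, List.getLast?_append,
        List.getLast?_singleton, Option.some_or, Option.mem_def, Option.some.injEq] at ha
      subst ha
      obtain rfl : c = d := h
      cases e
      · exact (hc hd).elim
      · rfl
    rw [mem_range_posWord_iff] at h ⊢
    intro p hp
    apply h
    rw [← FreeGroup.mk_toWord (x := v), posWord, FreeGroup.mul_mk, FreeGroup.toWord_mk,
      hred.reduce_eq]
    exact List.mem_append_right _ hp
  by_cases hf : (false, false) ∈ v.toWord.head?
  · refine key true m' h' fun ht => ?_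
    have := Option.mem_unique hf ht
    simp at this
  · exact key false m h hf

end PositiveWords

/-! ### Subgroups given by supports. -/

section SupportedSubgroups

open Equiv

theorem mem_conjSubgroup {G : Type*} [Group G] {g h : G} {B : Subgroup G} :
    h ∈ conjSubgroup g B ↔ g⁻¹ * h * g ∈ B := by
  rw [conjSubgroup, Subgroup.mem_map]
  constructor
  · rintro ⟨b, hb, rfl⟩
    simpa [mul_assoc] using hb
  · intro hb
    exact ⟨_, hb, by simp [mul_assoc]⟩

/-- For an action on `E` permuting the fibres of `π : E → X`, the subgroup of the elements that
preserve every fibre of `π` and fix all points outside the fibres over `D`. -/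
def supportedSubgroup {G E X : Type*} [Group G] (ρ : G →* Perm E) (π : E → X) (D : Set X) :
    Subgroup G where
  carrier := {g | ∀ e, π (ρ g e) = π e ∧ (π e ∉ D → ρ g e = e)}
  one_mem' := by simp
  mul_mem' := by
    intro a b ha hb e
    obtain ⟨hb1, hb2⟩ := hb e
    obtain ⟨ha1, ha2⟩ := ha (ρ b e)
    rw [map_mul, Perm.mul_apply]
    refine ⟨ha1.trans hb1, fun he => ?_⟩
    rw [ha2 (by rwa [hb1]), hb2 he]
  inv_mem' := by
    intro a ha e
    obtain ⟨h1, h2⟩ := ha ((ρ a)⁻¹ e)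
    rw [← Perm.mul_apply, mul_inv_cancel, Perm.one_apply] at h1 h2
    rw [map_inv]
    exact ⟨h1.symm, fun he => (h2 (by rwa [← h1])).symm⟩

variable {G E X : Type*} [Group G] {ρ : G →* Perm E} {σ : G →* Perm X} {π : E → X}

theorem mem_supportedSubgroup {D : Set X} {g : G} :
    g ∈ supportedSubgroup ρ π D ↔ ∀ e, π (ρ g e) = π e ∧ (π e ∉ D → ρ g e = e) := Iff.rfl

theorem supportedSubgroup_mono {D D' : Set X} (h : D ⊆ D') :
    supportedSubgroup ρ π D ≤ supportedSubgroup ρ π D' :=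
  fun _ hg e => ⟨(hg e).1, fun he => (hg e).2 fun he' => he (h he')⟩

/-- The substitution of `ρ g⁻¹ e` for `e` carries one defining condition to the other; the new
support is the image of `D` under `σ g`. -/
theorem conjSubgroup_supportedSubgroup (hπ : ∀ g e, π (ρ g e) = σ g (π e)) (g : G) (D : Set X) :
    conjSubgroup g (supportedSubgroup ρ π D) = supportedSubgroup ρ π (σ g⁻¹ ⁻¹' D) := by
  ext a
  rw [mem_conjSubgroup, mem_supportedSubgroup, mem_supportedSubgroup]
  rw [← (ρ g⁻¹).forall_congr_right]
  refine forall_congr' fun e => ?_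
  have h1 : ρ (g⁻¹ * a * g) (ρ g⁻¹ e) = ρ g⁻¹ (ρ a e) := by
    rw [← Perm.mul_apply, ← Perm.mul_apply, ← map_mul, ← map_mul]
    group
  rw [h1, hπ g⁻¹, hπ g⁻¹, (ρ g⁻¹).injective.eq_iff, (σ g⁻¹).injective.eq_iff, Set.mem_preimage]

/-- A point over the complement of the intersection lies over the complement of some `D i`. An empty
family is excluded since its infimum would not require fibres to be preserved. -/
theorem iInf_supportedSubgroup {ι : Type*} [Nonempty ι] (D : ι → Set X) :
    ⨅ i, supportedSubgroup ρ π (D i) = supportedSubgroup ρ π (⋂ i, D i) := by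
  ext a
  simp only [Subgroup.mem_iInf, mem_supportedSubgroup, Set.mem_iInter, not_forall]
  constructor
  · exact fun h e => ⟨(h (Classical.arbitrary ι) e).1, fun ⟨i, hi⟩ => (h i e).2 hi⟩
  · exact fun h i e => ⟨(h e).1, fun hi => (h e).2 ⟨i, hi⟩⟩

theorem iInf_conjSubgroup_supportedSubgroup {ι : Type*} [Nonempty ι]
    (hπ : ∀ g e, π (ρ g e) = σ g (π e)) (g : ι → G) (D : Set X) :
    ⨅ i, conjSubgroup (g i) (supportedSubgroup ρ π D) =
      supportedSubgroup ρ π (⋂ i, σ (g i)⁻¹ ⁻¹' D) := by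
  simp_rw [conjSubgroup_supportedSubgroup hπ, iInf_supportedSubgroup]

end SupportedSubgroups

/-! ### The action on `FreeGroup Bool` and its lift. -/

section LampAction

open Equiv

/-- The automorphism of the free group on two generators that exchanges the generators. -/
def swapGenerators : FreeGroup Bool ≃* FreeGroup Bool := FreeGroup.freeGroupCongr Equiv.boolNot

theorem swapGenerators_swapGenerators (w : FreeGroup Bool) :
    swapGenerators (swapGenerators w) = w := by
  have : (FreeGroup.map Bool.not).comp (FreeGroup.map Bool.not) = MonoidHom.id _ := by
    ext; simp
  exact DFunLike.congr_fun this w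

theorem swapGenerators_posWord (l : List Bool) :
    swapGenerators (posWord l) = posWord (l.map Bool.not) := by
  simp [swapGenerators, posWord, FreeGroup.freeGroupCongr, Function.comp_def, Equiv.boolNot]

/-- The exchange of the generators, together with a shift by one over the identity. -/
def lampSwap : Perm (FreeGroup Bool × ℤ) where
  toFun p := (swapGenerators p.1, p.2 + if p.1 = 1 then 1 else 0)
  invFun p := (swapGenerators p.1, p.2 - if p.1 = 1 then 1 else 0)
  left_inv p := by simp [swapGenerators_swapGenerators]
  right_inv p := by simp [swapGenerators_swapGenerators]

variable (n : ℕ)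

/-- The action of a free group on `FreeGroup Bool` by left multiplication by a generator and by
the exchange of the generators. -/
def baseAction : FreeGroup (Fin n) →* Perm (FreeGroup Bool) :=
  FreeGroup.lift fun i => if i.val = 0 then Equiv.mulLeft (posWord [false])
    else if i.val = 1 then swapGenerators.toEquiv else 1

/-- The lift of `baseAction` in which the second generator acts by `lampSwap`. -/
def lampAction : FreeGroup (Fin n) →* Perm (FreeGroup Bool × ℤ) :=
  FreeGroup.lift fun i => if i.val = 0 then Equiv.prodCongr (Equiv.mulLeft (posWord [false])) 1
    else if i.val = 1 then lampSwap else 1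

variable {n}

theorem lampAction_fst (g : FreeGroup (Fin n)) (e : FreeGroup Bool × ℤ) :
    (lampAction n g e).1 = baseAction n g e.1 := by
  have hgen : ∀ i e, (lampAction n (FreeGroup.of i) e).1 = baseAction n (FreeGroup.of i) e.1 := by
    intro i e
    simp only [lampAction, baseAction, FreeGroup.lift_apply_of]
    split_ifs <;> rfl
  induction g using FreeGroup.induction_on generalizing e with
  | C1 => simp
  | of i => exact hgen i e
  | inv_of i _ =>
    rw [map_inv, map_inv, Perm.eq_inv_iff_eq, ← hgen, ← Perm.mul_apply, mul_inv_cancel, Perm.one_apply]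
  | mul a b ha hb => rw [map_mul, map_mul, Perm.mul_apply, Perm.mul_apply, ha, hb]

/-- Left translations together with their composites with the exchange form a group, because the
exchange is an involutive automorphism. -/
theorem baseAction_eq (g : FreeGroup (Fin n)) : ∃ v, (∀ w, baseAction n g w = v * w) ∨
    ∀ w, baseAction n g w = v * swapGenerators w := by
  have hgen : ∀ i, ∃ v, (∀ w, baseAction n (FreeGroup.of i) w = v * w) ∨
      ∀ w, baseAction n (FreeGroup.of i) w = v * swapGenerators w := by
    intro i
    simp only [baseAction, FreeGroup.lift_apply_of]
    split_ifs
    · exact ⟨posWord [false], Or.inl fun w => rfl⟩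
    · exact ⟨1, Or.inr fun w => (one_mul _).symm⟩
    · exact ⟨1, Or.inl fun w => (one_mul _).symm⟩
  induction g using FreeGroup.induction_on with
  | C1 => exact ⟨1, Or.inl fun w => by simp⟩
  | of i => exact hgen i
  | inv_of i _ =>
    obtain ⟨v, hv | hv⟩ := hgen i
    · refine ⟨v⁻¹, Or.inl fun w => ?_⟩
      rw [map_inv, Perm.inv_eq_iff_eq, hv, mul_inv_cancel_left]
    · refine ⟨swapGenerators v⁻¹, Or.inr fun w => ?_⟩
      rw [map_inv, Perm.inv_eq_iff_eq, hv, ← map_mul, swapGenerators_swapGenerators,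
        mul_inv_cancel_left]
  | mul a b ha hb =>
    obtain ⟨v, hv⟩ := ha
    obtain ⟨v', hv'⟩ := hb
    simp only [map_mul, Perm.mul_apply]
    rcases hv with hv | hv <;> rcases hv' with hv' | hv' <;> simp only [hv, hv', map_mul,
      swapGenerators_swapGenerators, ← mul_assoc]
    · exact ⟨_, Or.inl fun w => rfl⟩
    · exact ⟨_, Or.inr fun w => rfl⟩
    · exact ⟨_, Or.inr fun w => rfl⟩
    · exact ⟨_, Or.inl fun w => rfl⟩

/-- Conjugating multiplication by one generator with the exchange gives multiplication by the other.
-/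
theorem exists_baseAction_eq_posWord_mul (hn : 2 ≤ n) (l : List Bool) :
    ∃ g, ∀ w, baseAction n g w = posWord l * w := by
  have h0 : ∀ w, baseAction n (FreeGroup.of ⟨0, by omega⟩) w = posWord [false] * w := by
    simp [baseAction]
  have h1 : ∀ w, baseAction n (FreeGroup.of ⟨1, by omega⟩) w = swapGenerators w := by
    simp [baseAction]
  induction l with
  | nil => exact ⟨1, fun w => by simp [posWord, ← FreeGroup.one_eq_mk]⟩
  | cons c l ih =>
    obtain ⟨g, hg⟩ := ih
    have hcl : posWord (c :: l) = posWord [c] * posWord l := posWord_append [c] l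
    cases c
    · refine ⟨FreeGroup.of ⟨0, by omega⟩ * g, fun w => ?_⟩
      rw [map_mul, Perm.mul_apply, h0, hg, hcl, mul_assoc]
    · refine ⟨FreeGroup.of ⟨1, by omega⟩ * FreeGroup.of ⟨0, by omega⟩ *
        FreeGroup.of ⟨1, by omega⟩ * g, fun w => ?_⟩
      simp only [map_mul, Perm.mul_apply]
      rw [hg, h1 (posWord l * w), h0, h1, map_mul, swapGenerators_swapGenerators,
        swapGenerators_posWord, hcl, mul_assoc]
      rfl

/-- The subgroups attached to the subsets of `FreeGroup Bool` through `lampAction`. -/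
abbrev lampSubgroup (n : ℕ) (D : Set (FreeGroup Bool)) : Subgroup (FreeGroup (Fin n)) :=
  supportedSubgroup (lampAction n) Prod.fst D

/-- The square of `lampSwap` is trivial on the base and shifts only the fibre over 1, which the
exchange fixes. A conjugate by an element taking 1 to `posWord l` shifts only the fibre over
`posWord l`. -/
theorem exists_mem_lampSubgroup_singleton (hn : 2 ≤ n) (l : List Bool) :
    ∃ t ∈ lampSubgroup n {posWord l}, ∀ D, t ∈ lampSubgroup n D → posWord l ∈ D := by
  obtain ⟨g, hg⟩ := exists_baseAction_eq_posWord_mul hn l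
  set τ := FreeGroup.of (⟨1, by omega⟩ : Fin n)
  have hτ : ∀ e, lampAction n (τ * τ) e = (e.1, e.2 + if e.1 = 1 then 2 else 0) := by
    intro e
    have h1 : lampAction n τ = lampSwap := by simp [lampAction, τ]
    rw [map_mul, Perm.mul_apply, h1]
    simp only [lampSwap, Equiv.coe_fn_mk, swapGenerators_swapGenerators,
      EmbeddingLike.map_eq_one_iff]
    split_ifs <;> simp [add_assoc]
  have hmem : ∀ D, g * (τ * τ) * g⁻¹ ∈ lampSubgroup n D ↔
      τ * τ ∈ lampSubgroup n (baseAction n g ⁻¹' D) := by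
    intro D
    have := conjSubgroup_supportedSubgroup (lampAction_fst (n := n)) g⁻¹ D
    rw [inv_inv] at this
    rw [lampSubgroup, lampSubgroup, ← this, mem_conjSubgroup, inv_inv]
  refine ⟨g * (τ * τ) * g⁻¹, ?_, fun D hD => ?_⟩
  · rw [hmem, mem_supportedSubgroup]
    intro e
    rw [hτ]
    refine ⟨rfl, fun he => ?_⟩
    rw [if_neg, add_zero]
    intro h
    apply he
    simp [h, hg]
  · rw [hmem, mem_supportedSubgroup] at hD
    by_contra hl
    have := (hD (1, 0)).2 (by simpa [hg] using hl)
    rw [hτ] at this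
    simp at this

end LampAction

/-! ### The Borel reduction. -/

section Reduction

variable {X : Type*} {h : ℕ → X → X} {P : ℕ → Set X} {n : ℕ}

/-- The code of a point as a set of positive elements of the free group. -/
def codeSet {X : Type*} (h : ℕ → X → X) (P : ℕ → Set X) (y : X) : Set (FreeGroup Bool) :=
  posWord '' pointCode h P y

theorem posWord_mem_codeSet {y : X} {l : List Bool} :
    posWord l ∈ codeSet h P y ↔ l ∈ pointCode h P y :=
  posWord_injective.mem_set_image

/-- Prepending a step word applies `h k`. The translate by 0 contains every positive word; with it,
`w` is forced to be positive, since the two left factors end in different letters. This is one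
purpose of the padding. -/
theorem mul_mem_codeSet_iff {y : X} {k : ℕ} {w : FreeGroup Bool} :
    w ∈ codeSet h P (h k y) ↔
      posWord (stepWord k) * w ∈ codeSet h P y ∧ posWord [false] * w ∈ codeSet h P y := by
  constructor
  · rintro ⟨l, hl, rfl⟩
    rw [← posWord_append, ← posWord_append, posWord_mem_codeSet, posWord_mem_codeSet]
    exact ⟨stepWord_append_mem_pointCode.2 hl, false_cons_mem_pointCode l⟩
  · rintro ⟨h1, h2⟩
    obtain ⟨l, rfl⟩ := mem_range_posWord_of_mul_left (v := w) (m := [])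
      (m' := List.replicate (k + 1) true ++ [false]) (Set.image_subset_range _ _ h2)
      (by simpa [stepWord] using Set.image_subset_range _ _ h1)
    rw [← posWord_append, posWord_mem_codeSet, stepWord_append_mem_pointCode] at h1
    exact posWord_mem_codeSet.2 h1

theorem infinite_lampSubgroup_codeSet (hn : 2 ≤ n) (y : X) :
    (lampSubgroup n (codeSet h P y) : Set (FreeGroup (Fin n))).Infinite := by
  choose t ht htD using exists_mem_lampSubgroup_singleton hn
  refine Set.infinite_of_injective_forall_mem
    (f := fun m : ℕ => t (false :: List.replicate m true)) (fun m m' hm => ?_) fun m => ?_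
  · have h1 := ht (false :: List.replicate m true)
    change t _ = t _ at hm
    rw [hm] at h1
    have h2 : posWord (false :: List.replicate m' true) = posWord (false :: List.replicate m true) :=
      htD _ {posWord (false :: List.replicate m true)} h1
    simpa using (congrArg List.length (posWord_injective h2)).symm
  · refine supportedSubgroup_mono ?_ (ht _)
    rintro _ rfl
    exact posWord_mem_codeSet.2 (false_cons_mem_pointCode _)

theorem conjIntersection_lampSubgroup_codeSet (hn : 2 ≤ n) (k : ℕ) (y : X) :
    ConjIntersection (lampSubgroup n (codeSet h P (h k y))) (lampSubgroup n (codeSet h P y)) := by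
  obtain ⟨a, ha⟩ := exists_baseAction_eq_posWord_mul hn (stepWord k)
  obtain ⟨b, hb⟩ := exists_baseAction_eq_posWord_mul hn [false]
  refine ⟨1, ![a⁻¹, b⁻¹], ?_⟩
  rw [iInf_conjSubgroup_supportedSubgroup lampAction_fst]
  congr 1
  ext w
  rw [Set.mem_iInter]
  refine mul_mem_codeSet_iff.trans (Iff.trans ?_ Fin.forall_fin_two.symm)
  simp only [Set.mem_preimage, Matrix.cons_val_zero, Matrix.cons_val_one, inv_inv, ha, hb]

/-- An element of the free group that maps the code of `x` into the code of `y`, but maps the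
identity outside the code of `y`, acts as the code of a composition of functions. -/
theorem exists_eq_applyList_of_baseAction {x y : X}
    (hsep : ∀ x x', (∀ j, x ∈ P j → x' ∈ P j) → x = x') {g : FreeGroup (Fin n)}
    (hg : ∀ w ∈ codeSet h P x, baseAction n g w ∈ codeSet h P y)
    (h1 : baseAction n g 1 ∉ codeSet h P y) : ∃ ks, x = applyList h ks y := by
  have hfull : ∀ m, baseAction n g (posWord (false :: m)) ∈ codeSet h P y := fun m =>
    hg _ (posWord_mem_codeSet.2 (false_cons_mem_pointCode m))
  have hstep : ∀ m, baseAction n g (posWord (stepWord 0 ++ false :: m)) ∈ codeSet h P y :=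
    fun m => hg _ (posWord_mem_codeSet.2
      (stepWord_append_mem_pointCode.2 (false_cons_mem_pointCode m)))
  have hr : ∀ {w}, w ∈ codeSet h P y → w ∈ Set.range posWord :=
    fun hw => Set.image_subset_range _ _ hw
  obtain ⟨v, hv | hv⟩ := baseAction_eq g
  · simp only [hv] at hg h1 hfull hstep
    -- Padding begins with 0 and step words with 1, so both products needed for positivity of `v`
    -- are available.
    obtain ⟨l, rfl⟩ := mem_range_posWord_of_mul (hr (hfull [])) (hr (hstep []))
    rw [mul_one, posWord_mem_codeSet] at h1
    have h2 := hfull []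
    rw [← posWord_append, posWord_mem_codeSet] at h2
    obtain ⟨ks, rfl⟩ := exists_eq_stepWords_of_append_false h1 h2
    refine ⟨ks, eq_applyList_of_subset hsep fun w hw => ?_⟩
    rw [← posWord_mem_codeSet, posWord_append]
    exact hg _ (posWord_mem_codeSet.2 hw)
  · simp only [hv, swapGenerators_posWord] at h1 hfull hstep
    obtain ⟨l, rfl⟩ := mem_range_posWord_of_mul (hr (hstep [])) (hr (hfull []))
    rw [map_one, mul_one, posWord_mem_codeSet] at h1
    -- The exchange turns 00 into the forbidden ending 11.
    have h2 := hfull [false]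
    rw [← posWord_append, posWord_mem_codeSet] at h2
    exact (append_true_true_notMem_pointCode h1 h2).elim

/-- The empty word is not in the code of `x`, so some translate in the intersection omits 1, and
this one translate contains the whole code of `x`. -/
theorem exists_eq_applyList_of_conjIntersection (hn : 2 ≤ n) {x y : X}
    (hsep : ∀ x x', (∀ j, x ∈ P j → x' ∈ P j) → x = x')
    (hxy : ConjIntersection (lampSubgroup n (codeSet h P x)) (lampSubgroup n (codeSet h P y))) :
    ∃ ks, x = applyList h ks y := by
  obtain ⟨m, g, hg⟩ := hxy
  rw [iInf_conjSubgroup_supportedSubgroup lampAction_fst] at hg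
  have hone : (1 : FreeGroup Bool) = posWord [] := FreeGroup.one_eq_mk
  have h1 : (1 : FreeGroup Bool) ∉ ⋂ i, baseAction n (g i)⁻¹ ⁻¹' codeSet h P y := by
    intro h1
    obtain ⟨t, ht, htD⟩ := exists_mem_lampSubgroup_singleton hn []
    have : t ∈ lampSubgroup n (codeSet h P x) := by
      rw [hg]
      refine supportedSubgroup_mono ?_ ht
      rintro _ rfl
      rwa [← hone]
    exact nil_notMem_pointCode (posWord_mem_codeSet.1 (htD _ this))
  rw [Set.mem_iInter, not_forall] at h1
  obtain ⟨i, hi⟩ := h1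
  refine exists_eq_applyList_of_baseAction (g := (g i)⁻¹) hsep ?_ hi
  rintro _ ⟨l, hl, rfl⟩
  obtain ⟨t, ht, htD⟩ := exists_mem_lampSubgroup_singleton hn l
  have : t ∈ lampSubgroup n (codeSet h P x) := by
    refine supportedSubgroup_mono ?_ ht
    rintro _ rfl
    exact posWord_mem_codeSet.2 hl
  rw [hg] at this
  exact Set.mem_iInter.1 (htD _ this) i

theorem measurable_lampSubgroup_codeSet [MeasurableSpace X] (hh : ∀ k, Measurable (h k))
    (hP : ∀ j, MeasurableSet (P j)) : Measurable fun y => lampSubgroup n (codeSet h P y) := by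
  refine measurable_comap_iff.2 (measurable_set_iff.2 fun g => measurable_to_prop ?_)
  have hD : ∀ w, MeasurableSet {y | w ∈ codeSet h P y} := by
    intro w
    by_cases hw : w ∈ Set.range posWord
    · obtain ⟨l, rfl⟩ := hw
      simpa only [posWord_mem_codeSet] using measurableSet_mem_pointCode hh hP l
    · have : {y | w ∈ codeSet h P y} = ∅ := by
        ext y
        exact iff_of_false (fun hy => hw (Set.image_subset_range _ _ hy)) (Set.notMem_empty _)
      rw [this]
      exact .empty
  have hset : (fun y => g ∈ (lampSubgroup n (codeSet h P y) : Set (FreeGroup (Fin n)))) ⁻¹' {True} =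
      ⋂ e : FreeGroup Bool × ℤ, {_y | (lampAction n g e).1 = e.1} ∩
        ({y | e.1 ∈ codeSet h P y} ∪ {_y | lampAction n g e = e}) := by
    ext y
    simp only [Set.mem_preimage, Set.mem_singleton_iff, eq_iff_iff, iff_true, SetLike.mem_coe,
      mem_supportedSubgroup, Set.mem_iInter, Set.mem_inter_iff, Set.mem_union, Set.mem_ofPred_eq,
      or_iff_not_imp_left]
  have : Countable (FreeGroup Bool) := Quot.mk_surjective.countable
  change MeasurableSet ((fun y => g ∈ (lampSubgroup n (codeSet h P y) :
    Set (FreeGroup (Fin n)))) ⁻¹' {True})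
  rw [hset]
  exact .iInter fun e => .inter (.const _) (.union (hD _) (.const _))

theorem exists_separating_sequence (X : Type*) [MeasurableSpace X] [StandardBorelSpace X] :
    ∃ P : ℕ → Set X, (∀ j, MeasurableSet (P j)) ∧
      ∀ x x', (∀ j, x ∈ P j → x' ∈ P j) → x = x' := by
  obtain ⟨f, hf, hfi⟩ := MeasurableSpace.measurable_injection_nat_bool_of_countablySeparated X
  -- The index `j` encodes a coordinate and a bit. Both values of the bit occur, so one-sided
  -- inclusion already forces equality.
  refine ⟨fun j => {x | f x j.div2 = j.bodd}, fun j => ?_, fun x x' hx => hfi ?_⟩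
  · exact (measurable_pi_iff.1 hf j.div2) (measurableSet_singleton j.bodd)
  · funext i
    have := hx (Nat.bit (f x i) i)
    simp only [Set.mem_ofPred_eq, Nat.div2_bit, Nat.bodd_bit, true_imp_iff] at this
    exact this.symm

theorem IsCountableBorelQuasiOrder.borelReducible_conjIntersectionInf (hn : 2 ≤ n)
    [MeasurableSpace X] {Q : X → X → Prop} (hQ : IsCountableBorelQuasiOrder Q) :
    BorelReducible Q (ConjIntersectionInf (FreeGroup (Fin n))) := by
  have := hQ.standardBorel
  obtain ⟨h, hh, hhQ⟩ := hQ.exists_measurable_functions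
  obtain ⟨P, hP, hsep⟩ := exists_separating_sequence X
  refine ⟨fun y => ⟨lampSubgroup n (codeSet h P y), infinite_lampSubgroup_codeSet hn y⟩,
    (measurable_lampSubgroup_codeSet hh hP).subtype_mk, fun x y => ⟨fun hxy => ?_, fun hxy => ?_⟩⟩
  · obtain ⟨k, rfl⟩ := (hhQ x y).1 hxy
    exact conjIntersection_lampSubgroup_codeSet hn k y
  · obtain ⟨ks, rfl⟩ := exists_eq_applyList_of_conjIntersection hn hsep hxy
    clear hxy
    induction ks generalizing y with
    | nil => exact hQ.refl y
    | cons k ks ih => exact hQ.trans _ _ _ (ih (h k y)) ((hhQ _ _).2 ⟨k, rfl⟩)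

end Reduction

/-! ### The space of subgroups is standard Borel and the relation is a countable Borel quasi-order.
-/

section SubgroupSpace

theorem standardBorelSpace_of_comap {Y Z : Type*} [mY : MeasurableSpace Y] [mZ : MeasurableSpace Z]
    [StandardBorelSpace Z] {f : Y → Z} (hf : Function.Injective f)
    (hr : MeasurableSet (Set.range f)) (hm : mY = mZ.comap f) : StandardBorelSpace Y := by
  obtain ⟨t, hb, ht⟩ := hr.standardBorel.polish
  let e : Y ≃ Set.range f := Equiv.ofInjective f hf
  refine ⟨t.induced e, @BorelSpace.mk _ (t.induced e) _ ?_, @Equiv.polishSpace_induced _ _ t ht e⟩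
  rw [borel_comap, ← hb.measurable_eq, hm, Subtype.instMeasurableSpace,
    MeasurableSpace.comap_comp]
  rfl

variable {G : Type*} [Group G]

theorem measurableSet_mem_subgroup (g : G) : MeasurableSet {H : Subgroup G | g ∈ H} :=
  measurableSet_setOfPred.2 (measurable_set_iff.1 (comap_measurable _) g)

theorem mem_iInf_conjSubgroup {ι : Type*} {g : ι → G} {B : Subgroup G} {a : G} :
    a ∈ ⨅ i, conjSubgroup (g i) B ↔ ∀ i, (g i)⁻¹ * a * g i ∈ B := by
  simp only [Subgroup.mem_iInf, mem_conjSubgroup]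

theorem conjIntersection_refl (A : Subgroup G) : ConjIntersection A A :=
  ⟨0, fun _ => 1, by ext a; simp [mem_conjSubgroup]⟩

theorem ConjIntersection.trans {A B C : Subgroup G} (hAB : ConjIntersection A B)
    (hBC : ConjIntersection B C) : ConjIntersection A C := by
  obtain ⟨m, g, rfl⟩ := hAB
  obtain ⟨k, h, rfl⟩ := hBC
  -- Conjugates of conjugates are indexed by pairs, and (m + 1)(k + 1) = (mk + m + k) + 1.
  let e : Fin (m + 1) × Fin (k + 1) ≃ Fin (m * k + m + k + 1) :=
    finProdFinEquiv.trans (finCongr (by ring))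
  refine ⟨m * k + m + k, fun i => g (e.symm i).1 * h (e.symm i).2, ?_⟩
  ext a
  simp only [mem_iInf_conjSubgroup]
  rw [e.symm.forall_congr_left]
  simp [mul_assoc, Prod.forall]

variable [Countable G]

theorem standardBorelSpace_subgroup : StandardBorelSpace (Subgroup G) := by
  have hstd : StandardBorelSpace (Set G) := inferInstanceAs (StandardBorelSpace (G → Prop))
  have hmem : ∀ g : G, MeasurableSet {s : Set G | g ∈ s} := fun g =>
    measurableSet_setOfPred.2 (measurable_set_iff.1 measurable_id g)
  have hrange : MeasurableSet (Set.range ((↑) : Subgroup G → Set G)) := by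
    have : Set.range ((↑) : Subgroup G → Set G) = {s | (1 : G) ∈ s} ∩
        ((⋂ a : G, ⋂ b : G, {s | a ∈ s}ᶜ ∪ ({s | b ∈ s}ᶜ ∪ {s | a * b ∈ s})) ∩
        ⋂ a : G, {s | a ∈ s}ᶜ ∪ {s | a⁻¹ ∈ s}) := by
      ext s
      simp only [Set.mem_range, Set.mem_inter_iff, Set.mem_iInter, Set.mem_union,
        Set.mem_compl_iff, Set.mem_ofPred_eq, ← imp_iff_not_or]
      constructor
      · rintro ⟨H, rfl⟩
        exact ⟨H.one_mem, fun a b ha hb => H.mul_mem ha hb, fun a ha => H.inv_mem ha⟩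
      · rintro ⟨h1, hm, hi⟩
        exact ⟨⟨⟨⟨s, fun ha hb => hm _ _ ha hb⟩, h1⟩, fun ha => hi _ ha⟩, rfl⟩
    rw [this]
    exact (hmem 1).inter ((MeasurableSet.iInter fun a => .iInter fun b =>
      (hmem a).compl.union ((hmem b).compl.union (hmem _))).inter
      (.iInter fun a => (hmem a).compl.union (hmem _)))
  exact standardBorelSpace_of_comap SetLike.coe_injective hrange rfl

theorem measurableSet_infinite_subgroup :
    MeasurableSet {H : Subgroup G | (H : Set G).Infinite} := by
  have : {H : Subgroup G | (H : Set G).Infinite} =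
      ⋂ t : Finset G, ⋃ g : {g // g ∉ t}, {H : Subgroup G | g.1 ∈ H} := by
    ext H
    simp only [Set.mem_ofPred_eq, Set.mem_iInter, Set.mem_iUnion, Subtype.exists, exists_prop]
    constructor
    · intro hH t
      obtain ⟨g, hg, hgt⟩ := hH.exists_notMem_finset t
      exact ⟨g, hgt, hg⟩
    · intro hH hfin
      obtain ⟨g, hg, hgH⟩ := hH hfin.toFinset
      exact hg (hfin.mem_toFinset.2 hgH)
  rw [this]
  exact .iInter fun t => .iUnion fun g => measurableSet_mem_subgroup g.1

theorem isCountableBorelQuasiOrder_conjIntersectionInf :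
    IsCountableBorelQuasiOrder (ConjIntersectionInf G) where
  standardBorel :=
    have := standardBorelSpace_subgroup (G := G)
    measurableSet_infinite_subgroup.standardBorel
  refl A := conjIntersection_refl A.1
  trans _ _ _ := ConjIntersection.trans
  borel := by
    have hm : ∀ g : G, MeasurableSet {A : InfiniteSubgroup G | g ∈ A.1} := fun g =>
      measurable_subtype_coe (measurableSet_mem_subgroup g)
    -- As `G` is countable, there are countably many tuples, and equality of subgroups is tested one
    -- element at a time.
    have : {p : InfiniteSubgroup G × InfiniteSubgroup G | ConjIntersectionInf G p.1 p.2} =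
        ⋃ n : ℕ, ⋃ g : Fin (n + 1) → G, ⋂ a : G, {p | a ∈ p.1.1 ↔
          p ∈ ⋂ i, Prod.snd ⁻¹' {A : InfiniteSubgroup G | (g i)⁻¹ * a * g i ∈ A.1}} := by
      ext p
      simp only [ConjIntersectionInf, ConjIntersection, Set.mem_ofPred_eq, Set.mem_iUnion,
        Set.mem_iInter, SetLike.ext_iff, mem_iInf_conjSubgroup, Set.mem_preimage]
    rw [this]
    refine .iUnion fun n => .iUnion fun g => .iInter fun a => ?_
    exact MeasurableSet.iff (measurable_fst (hm a))
      (.iInter fun i => measurable_snd (hm _))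
  countable_below B := by
    have : (Set.range fun x : Σ n : ℕ, Fin (n + 1) → G =>
        ⨅ i, conjSubgroup (x.2 i) B.1).Countable := Set.countable_range _
    refine (this.preimage Subtype.val_injective).mono ?_
    rintro A ⟨n, g, hA⟩
    exact ⟨⟨n, g⟩, hA.symm⟩

end SubgroupSpace

theorem mainTheorem10 (n : ℕ) (hn : 2 ≤ n) :
    IsUniversalCountableBorelQuasiOrder.{u, 0} (ConjIntersectionInf (FreeGroup (Fin n))) := by
  have : Countable (FreeGroup (Fin n)) := Quot.mk_surjective.countable
  exact ⟨isCountableBorelQuasiOrder_conjIntersectionInf,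
    fun _ _ _ hQ => hQ.borelReducible_conjIntersectionInf hn⟩
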